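/- Let $x_0<x_1$ be real numbers and $X=(x_0,x_1)$. For $x\in(x_0,x_1]$, a real-valued $\alpha\in L^1(X)$ and $\sigma\in\mathbb{C}$, define the harmonic exponential \[ E^{(x_0,x)}_\alpha(\sigma)=1+\sum_{j=1}^\infty\ \int_{x_0<s_1<\cdots<s_j<x}e^{2i\sigma\kappa(s_1,\ldots,s_j)}\prod_{\nu=1}^j\alpha(s_\nu)\,ds_1\cdots ds_j , \] where \[ \kappa(s_1,\ldots,s_j)=\begin{cases}(s_j-s_{j-1})+(s_{j-2}-s_{j-3})+\cdots+(s_2-s_1)&\text{if } j \text{ is even},\\ (s_j-s_{j-1})+(s_{j-2}-s_{j-3})+\cdots+(s_3-s_2)+(s_1-x_0)&\text{if } j\text{ is odd},\end{cases} \] and set $\operatorname{Cosh}^{(x_0,x)}_\alpha=\tfrac12\bigl(E^{(x_0,x)}_\alpha+E^{(x_0,x)}_{-\alpha}\bigr)$ and $\operatorname{Sech}^{(x_0,x)}_\alpha=1/\operatorname{Cosh}^{(x_0,x)}_\alpha$. Proposition. For every real-valued $\alpha\in L^1(X)$ and every $x\in(x_0,x_1]$, the integrals and the series defining $E^{(x_0,x)}_\alpha(\sigma)$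 converge absolutely for every $\sigma\in\mathbb{C}$, and the following hold. 1. $E^{(x_0,x)}_\alpha(\sigma)$ is an entire function of $\sigma\in\mathbb{C}$. 2. $E^{(x_0,x)}_\alpha(\sigma)\to1$ as $|\sigma|\to\infty$ with $\sigma\in\mathbb{R}$. 3. $\operatorname{Re}\Bigl(E^{(x_0,x)}_\alpha(\sigma)\,\overline{E^{(x_0,x)}_{-\alpha}(\sigma)}\Bigr)=1$ for every $\sigma\in\mathbb{R}$. 4. If $\operatorname{Im}\sigma\ge0$, then $E^{(x_0,x)}_\alpha(\sigma)\neq0$ and $E^{(x_0,x)}_\alpha(\sigma)+E^{(x_0,x)}_{-\alpha}(\sigma)\neq0$. 5. If $\operatorname{Im}\sigma\ge0$, then $\bigl|E^{(x_0,x)}_\alpha(\sigma)+E^{(x_0,x)}_{-\alpha}(\sigma)\bigr|\ge\sqrt2$. 6. $\operatorname{Sech}^{(x_0,x)}_\alpha(i)$ is real and $\operatorname{Sech}^{(x_0,x)}_\alpha(i)>0$. -/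

import Mathlib

open MeasureTheory Set Filter Topology

noncomputable section

/-- The phase `κ(s₁, …, s_j)`, i.e. the alternating sum `s_j - s_{j-1} + s_{j-2} - ⋯ ± s₁`, from
which `x₀` is subtracted when `j` is odd:
`(s_j - s_{j-1}) + ⋯ + (s₂ - s₁)` for even `j`, and
`(s_j - s_{j-1}) + ⋯ + (s₃ - s₂) + (s₁ - x₀)` for odd `j`.
Here `s_ν` is `s i` with `i = ν - 1`. -/
def hexpKappa (x₀ : ℝ) (j : ℕ) (s : Fin j → ℝ) : ℝ :=
  (∑ i : Fin j, (-1 : ℝ) ^ (j - (i.val + 1)) * s i) - (if Odd j then x₀ else 0)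

/-- The simplex `x₀ < s₁ < ⋯ < s_j < x` in `ℝ^j`. -/
def hexpSimplex (x₀ x : ℝ) (j : ℕ) : Set (Fin j → ℝ) :=
  {s | StrictMono s ∧ ∀ i, s i ∈ Ioo x₀ x}

/-- The integrand `exp(2 i σ κ(s₁, …, s_j)) ∏ α(s_ν)`. -/
def hexpIntegrand (x₀ : ℝ) (α : ℝ → ℝ) (σ : ℂ) (j : ℕ) (s : Fin j → ℝ) : ℂ :=
  Complex.exp (2 * Complex.I * σ * (hexpKappa x₀ j s : ℂ)) * ∏ i : Fin j, (α (s i) : ℂ)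

/-- The `j`-th summand of the harmonic exponential. -/
def hexpTerm (x₀ x : ℝ) (α : ℝ → ℝ) (σ : ℂ) (j : ℕ) : ℂ :=
  ∫ s in hexpSimplex x₀ x j, hexpIntegrand x₀ α σ j s

/-- The harmonic exponential `E_α^{(x₀,x)}(σ)`: one plus the sum of the `j`-th summands over
`j ≥ 1`. -/
def hexp (x₀ x : ℝ) (α : ℝ → ℝ) (σ : ℂ) : ℂ :=
  1 + ∑' n : ℕ, hexpTerm x₀ x α σ (n + 1)

/-- `Cosh_α^{(x₀,x)}(σ)`. -/
def hexpCosh (x₀ x : ℝ) (α : ℝ → ℝ) (σ : ℂ) : ℂ :=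
  (hexp x₀ x α σ + hexp x₀ x (-α) σ) / 2

/-- `Sech_α^{(x₀,x)}(σ)`. -/
def hexpSech (x₀ x : ℝ) (α : ℝ → ℝ) (σ : ℂ) : ℂ :=
  1 / hexpCosh x₀ x α σ

end

/-! Splitting off the largest variable of the simplex turns the multiple integrals into a Picard
iteration in the endpoint `x`. With `φ(t) = e^{2iσ(t-x₀)}` it gives `E_α(σ)' = φ α E_α(-σ)` almost
everywhere, and with `-σ` in place of `σ` a closed linear system for the pair `E_α(±σ)`, with value
`1` at `x₀`. Factorial bounds on the iterates give convergence and analyticity; on the real line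
they are uniform in `σ`, so Riemann–Lebesgue gives the limit.

Two facts about the system carry the rest. First, `E_α(σ)E_{-α}(-σ) + E_α(-σ)E_{-α}(σ)` is constant,
equal to `2` (`hexp_mul_add_mul_eq_two`); for real `σ` this is the real part identity. Second, for
`Im σ ≥ 0` an energy is monotone in `x` (`energy_le`). Applied to `E_α(±σ)` it excludes zeros;
applied to the sum and difference of `E_α` and `E_{-α}` it gives the lower bound, even with `2` in
place of `√2`. Positivity of `Sech_α(i)` follows by moving the endpoint from `x₀` to `x`. -/

/-- `u` is absolutely continuous on `[a, b]` with derivative `f` almost everywhere. -/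
structure ACHasDeriv {E : Type*} [NormedAddCommGroup E] [NormedSpace ℝ E]
    (u f : ℝ → E) (a b : ℝ) : Prop where
  ac : AbsolutelyContinuousOnInterval u a b
  deriv : ∀ᵐ x, x ∈ uIcc a b → HasDerivAt u (f x) x

/-! ### Calculus of absolutely continuous functions -/

namespace ACHasDeriv

variable {E F : Type*} [NormedAddCommGroup E] [NormedSpace ℝ E] [NormedAddCommGroup F]
  [NormedSpace ℝ F] {a b : ℝ}

theorem const (c : E) : ACHasDeriv (fun _ => c) (fun _ => 0) a b where
  ac := (LipschitzWith.const c).lipschitzOnWith.absolutelyContinuousOnInterval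
  deriv := Eventually.of_forall fun x _ => hasDerivAt_const x c

theorem of_contDiff {u f : ℝ → E} (hu : ContDiff ℝ 1 u) (h : ∀ x, HasDerivAt u (f x) x) :
    ACHasDeriv u f a b where
  ac := hu.contDiffOn.absolutelyContinuousOnInterval
  deriv := Eventually.of_forall fun x _ => h x

theorem integral [CompleteSpace E] {f : ℝ → E} (hf : Integrable f) :
    ACHasDeriv (fun x => ∫ t in a..x, f t) f a b where
  ac := by
    have h := (hf.norm.intervalIntegrable
      (a := a) (b := b)).absolutelyContinuousOnInterval_intervalIntegral left_mem_uIcc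
    refine squeeze_zero (fun t => Finset.sum_nonneg fun i _ => dist_nonneg) (fun t => ?_) h
    refine Finset.sum_le_sum fun i _ => ?_
    rw [dist_eq_norm, dist_eq_norm,
      intervalIntegral.integral_interval_sub_left hf.intervalIntegrable hf.intervalIntegrable,
      intervalIntegral.integral_interval_sub_left hf.norm.intervalIntegrable
        hf.norm.intervalIntegrable]
    exact intervalIntegral.norm_integral_le_abs_integral_norm
  deriv := by
    filter_upwards [LocallyIntegrable.ae_hasDerivAt_integral hf.locallyIntegrable] with x hx _ using hx a

theorem congr {u f u' f' : ℝ → E} (h : ACHasDeriv u f a b) (hu : u' = u) (hf : f' = f) :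
    ACHasDeriv u' f' a b := by subst hu hf; exact h

theorem add {u f v g : ℝ → E} (hu : ACHasDeriv u f a b) (hv : ACHasDeriv v g a b) :
    ACHasDeriv (fun x => u x + v x) (fun x => f x + g x) a b where
  ac := hu.ac.add hv.ac
  deriv := by
    filter_upwards [hu.deriv, hv.deriv] with x h₁ h₂ hx using (h₁ hx).add (h₂ hx)

theorem sub {u f v g : ℝ → E} (hu : ACHasDeriv u f a b) (hv : ACHasDeriv v g a b) :
    ACHasDeriv (fun x => u x - v x) (fun x => f x - g x) a b where
  ac := hu.ac.sub hv.ac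
  deriv := by
    filter_upwards [hu.deriv, hv.deriv] with x h₁ h₂ hx using (h₁ hx).sub (h₂ hx)

theorem mul {A : Type*} [NormedRing A] [NormedAlgebra ℝ A] [NormMulClass A] {u f v g : ℝ → A}
    (hu : ACHasDeriv u f a b) (hv : ACHasDeriv v g a b) :
    ACHasDeriv (fun x => u x * v x) (fun x => f x * v x + u x * g x) a b where
  ac := hu.ac.smul hv.ac
  deriv := by
    filter_upwards [hu.deriv, hv.deriv] with x h₁ h₂ hx using (h₁ hx).mul (h₂ hx)

theorem clm {u f : ℝ → E} (hu : ACHasDeriv u f a b) (L : E →L[ℝ] F) :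
    ACHasDeriv (fun x => L (u x)) (fun x => L (f x)) a b where
  ac := by
    refine squeeze_zero (fun t => Finset.sum_nonneg fun i _ => dist_nonneg) (fun t => ?_)
      (by simpa using Tendsto.const_mul ‖L‖ hu.ac)
    rw [Finset.mul_sum]
    refine Finset.sum_le_sum fun i _ => ?_
    rw [dist_eq_norm, dist_eq_norm, ← map_sub]
    exact L.le_opNorm _
  deriv := by
    filter_upwards [hu.deriv] with x h₁ hx using L.hasFDerivAt.comp_hasDerivAt x (h₁ hx)

theorem integral_eq {u f : ℝ → ℝ} (hu : ACHasDeriv u f a b) :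
    ∫ t in a..b, f t = u b - u a := by
  rw [← hu.ac.integral_deriv_eq_sub]
  refine intervalIntegral.integral_congr_ae ?_
  filter_upwards [hu.deriv] with x h hx using ((h (uIoc_subset_uIcc hx)).deriv).symm

theorem le_of_nonneg {u f : ℝ → ℝ} (hu : ACHasDeriv u f a b) (hab : a ≤ b)
    (hf : ∀ t ∈ Icc a b, 0 ≤ f t) : u a ≤ u b := by
  have := intervalIntegral.integral_nonneg hab hf (μ := volume)
  rw [hu.integral_eq] at this
  linarith

theorem eq_of_zero {u : ℝ → E} (hu : ACHasDeriv u (fun _ => 0) a b) : u b = u a := by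
  obtain ⟨C, hC⟩ := hu.ac.const_of_ae_hasDerivAt_zero hu.deriv
  rw [hC _ right_mem_uIcc, hC _ left_mem_uIcc]

theorem pow {u f : ℝ → ℝ} (hu : ACHasDeriv u f a b) (n : ℕ) :
    ACHasDeriv (fun x => u x ^ n) (fun x => n * u x ^ (n - 1) * f x) a b := by
  induction n with
  | zero => simpa using const (1 : ℝ)
  | succ n ih =>
    refine (ih.mul hu).congr ?_ ?_
    · ext x; exact pow_succ _ _
    · ext x
      rcases n with _ | n
      · simp
      · simp only [Nat.add_sub_cancel]; push_cast; ring

end ACHasDeriv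

/-! ### Simplex integrals and their recursion -/

section HarmonicExponential

open scoped ComplexConjugate

variable {α : ℝ → ℝ}

/-- A new top variable flips every earlier sign of the alternating sum and the parity of `j`. This
is the source of the coupling between `σ` and `-σ`. -/
theorem hexpKappa_snoc (x₀ : ℝ) (j : ℕ) (s : Fin j → ℝ) (t : ℝ) :
    hexpKappa x₀ (j + 1) (Fin.snoc s t : Fin (j + 1) → ℝ) = (t - x₀) - hexpKappa x₀ j s := by
  have h : ∀ i : Fin j, (-1 : ℝ) ^ (j - i.val) = -(-1 : ℝ) ^ (j - (i.val + 1)) := fun i => by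
    rw [show j - i.val = (j - (i.val + 1)) + 1 by omega, pow_succ]; ring
  simp only [hexpKappa, Fin.sum_univ_castSucc, Fin.snoc_castSucc, Fin.snoc_last, Fin.val_castSucc,
    Fin.val_last, Nat.sub_self, pow_zero, one_mul, Nat.add_sub_add_right, h, Nat.odd_add_one,
    neg_mul, Finset.sum_neg_distrib]
  split_ifs <;> first | contradiction | ring

theorem snoc_mem_hexpSimplex {x₀ x : ℝ} {j : ℕ} {s : Fin j → ℝ} {t : ℝ} :
    (Fin.snoc s t : Fin (j + 1) → ℝ) ∈ hexpSimplex x₀ x (j + 1) ↔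
      t ∈ Ioo x₀ x ∧ s ∈ hexpSimplex x₀ t j := by
  constructor
  · rintro ⟨hm, hI⟩
    have ht : t ∈ Ioo x₀ x := by simpa using hI (Fin.last j)
    refine ⟨ht, fun a b hab => ?_, fun i => ⟨?_, ?_⟩⟩
    · simpa using hm (Fin.castSucc_lt_castSucc_iff.2 hab)
    · simpa using (hI i.castSucc).1
    · simpa using hm (Fin.castSucc_lt_last i)
  · rintro ⟨ht, hm, hI⟩
    refine ⟨fun a b hab => ?_, fun i => ?_⟩
    · induction b using Fin.lastCases with
      | last =>
        induction a using Fin.lastCases with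
        | last => exact absurd hab (lt_irrefl _)
        | cast a => simpa using (hI a).2
      | cast b =>
        induction a using Fin.lastCases with
        | last => exact absurd hab (not_lt.2 (Fin.le_last _))
        | cast a => simpa using hm (Fin.castSucc_lt_castSucc_iff.1 hab)
    · induction i using Fin.lastCases with
      | last => simpa using ht
      | cast i => simpa using ⟨(hI i).1, (hI i).2.trans ht.2⟩

theorem hexpIntegrand_snoc (x₀ : ℝ) (α : ℝ → ℝ) (σ : ℂ) (j : ℕ) (s : Fin j → ℝ) (t : ℝ) :
    hexpIntegrand x₀ α σ (j + 1) (Fin.snoc s t : Fin (j + 1) → ℝ) =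
      Complex.exp (2 * Complex.I * σ * (t - x₀)) * α t * hexpIntegrand x₀ α (-σ) j s := by
  simp only [hexpIntegrand, hexpKappa_snoc, Fin.prod_univ_castSucc, Fin.snoc_castSucc,
    Fin.snoc_last]
  have : (2 * Complex.I * σ * (((t - x₀) - hexpKappa x₀ j s : ℝ) : ℂ)) =
      2 * Complex.I * σ * (t - x₀) + 2 * Complex.I * (-σ) * (hexpKappa x₀ j s : ℂ) := by
    push_cast; ring
  rw [this, Complex.exp_add]
  ring

theorem continuous_hexpKappa (x₀ : ℝ) (j : ℕ) : Continuous (hexpKappa x₀ j) := by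
  unfold hexpKappa
  fun_prop

theorem measurableSet_hexpSimplex (x₀ x : ℝ) (j : ℕ) : MeasurableSet (hexpSimplex x₀ x j) := by
  have : hexpSimplex x₀ x j =
      (⋂ (a : Fin j) (b : Fin j) (_ : a < b), {s | s a < s b}) ∩ ⋂ i, {s | s i ∈ Ioo x₀ x} := by
    ext s; simp [hexpSimplex, StrictMono]
  rw [this]
  refine MeasurableSet.inter ?_ ?_
  · exact .iInter fun a => .iInter fun b => .iInter fun _ =>
      measurableSet_lt (measurable_pi_apply a) (measurable_pi_apply b)
  · exact .iInter fun i => measurable_pi_apply i measurableSet_Ioo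

theorem hexpSimplex_subset_Icc (x₀ x : ℝ) (j : ℕ) :
    hexpSimplex x₀ x j ⊆ Icc (fun _ => x₀) (fun _ => x) :=
  fun _ hs => ⟨fun i => (hs.2 i).1.le, fun i => (hs.2 i).2.le⟩

theorem exists_abs_hexpKappa_le (x₀ x : ℝ) (j : ℕ) :
    ∃ K, ∀ s ∈ hexpSimplex x₀ x j, |hexpKappa x₀ j s| ≤ K := by
  obtain ⟨K, hK⟩ := (isCompact_Icc (a := fun _ : Fin j => x₀)
    (b := fun _ => x)).exists_bound_of_continuousOn (continuous_hexpKappa x₀ j).continuousOn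
  exact ⟨K, fun s hs => hK s (hexpSimplex_subset_Icc x₀ x j hs)⟩

theorem integrable_prod_ofReal (hα : Integrable α) (j : ℕ) :
    Integrable fun s : Fin j → ℝ => ∏ i, (α (s i) : ℂ) :=
  Integrable.fintype_prod (fun _ => hα.ofReal)

theorem integrableOn_hexpIntegrand (hα : Integrable α) (x₀ x : ℝ) (σ : ℂ) (j : ℕ) :
    IntegrableOn (hexpIntegrand x₀ α σ j) (hexpSimplex x₀ x j) := by
  refine IntegrableOn.mono_set ?_ (hexpSimplex_subset_Icc x₀ x j)
  refine IntegrableOn.continuousOn_mul ?_ (integrable_prod_ofReal hα j).integrableOn isCompact_Icc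
  have := continuous_hexpKappa x₀ j
  fun_prop

theorem hexpTerm_zero (x₀ x : ℝ) (α : ℝ → ℝ) (σ : ℂ) : hexpTerm x₀ x α σ 0 = 1 := by
  have h : hexpSimplex x₀ x 0 = univ := by
    ext s; simp [hexpSimplex, Subsingleton.strictMono]
  simp [hexpTerm, h, hexpIntegrand, hexpKappa, integral_unique, Measure.real, volume_pi]

theorem hexpTerm_succ (hα : Integrable α) (x₀ x : ℝ) (σ : ℂ) (j : ℕ) :
    hexpTerm x₀ x α σ (j + 1) =
      ∫ t in Ioo x₀ x, Complex.exp (2 * Complex.I * σ * (t - x₀)) * α t *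
        hexpTerm x₀ t α (-σ) j := by
  have hint := (integrable_indicator_iff (measurableSet_hexpSimplex x₀ x (j + 1))).2
    (integrableOn_hexpIntegrand hα x₀ x σ (j + 1))
  have hmp := (volume_preserving_piFinSuccAbove (fun _ : Fin (j + 1) => ℝ) (Fin.last j)).symm
  have key : ∀ p : ℝ × (Fin j → ℝ),
      (hexpSimplex x₀ x (j + 1)).indicator (hexpIntegrand x₀ α σ (j + 1))
        ((MeasurableEquiv.piFinSuccAbove (fun _ : Fin (j + 1) => ℝ) (Fin.last j)).symm p) =
      (Ioo x₀ x).indicator (fun t => Complex.exp (2 * Complex.I * σ * (t - x₀)) * α t *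
        (hexpSimplex x₀ t j).indicator (hexpIntegrand x₀ α (-σ) j) p.2) p.1 := by
    rintro ⟨t, s⟩
    have : (MeasurableEquiv.piFinSuccAbove (fun _ : Fin (j + 1) => ℝ) (Fin.last j)).symm (t, s) =
        (Fin.snoc s t : Fin (j + 1) → ℝ) := Fin.insertNth_last' t s
    rw [this]
    by_cases ht : t ∈ Ioo x₀ x
    · by_cases hs : s ∈ hexpSimplex x₀ t j
      · rw [indicator_of_mem (snoc_mem_hexpSimplex.2 ⟨ht, hs⟩), indicator_of_mem ht,
          indicator_of_mem hs, hexpIntegrand_snoc]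
      · rw [indicator_of_notMem (fun h => hs (snoc_mem_hexpSimplex.1 h).2), indicator_of_mem ht,
          indicator_of_notMem hs, mul_zero]
    · rw [indicator_of_notMem (fun h => ht (snoc_mem_hexpSimplex.1 h).1), indicator_of_notMem ht]
  have hint' := (hmp.integrable_comp_emb (MeasurableEquiv.measurableEmbedding _)).2 hint
  simp only [Function.comp_def, key] at hint'
  rw [hexpTerm, ← integral_indicator (measurableSet_hexpSimplex x₀ x (j + 1)),
    ← hmp.integral_comp', ← integral_indicator measurableSet_Ioo]
  simp only [key]
  rw [Measure.volume_eq_prod] at hint' ⊢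
  rw [integral_prod _ hint']
  congr 1
  ext t
  by_cases ht : t ∈ Ioo x₀ x
  · simp only [indicator_of_mem ht]
    rw [integral_const_mul, integral_indicator (measurableSet_hexpSimplex x₀ t j), hexpTerm]
  · simp only [indicator_of_notMem ht, integral_zero]

/-- Differentiation under the integral sign: `κ` is bounded on the simplex, so for `σ` in a unit
ball a constant multiple of `∏ |α(s_i)|` dominates the derivative. -/
theorem differentiable_hexpTerm (hα : Integrable α) (x₀ x : ℝ) (j : ℕ) :
    Differentiable ℂ fun σ => hexpTerm x₀ x α σ j := by
  intro σ₀
  obtain ⟨K, hK⟩ := exists_abs_hexpKappa_le x₀ x j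
  have hκ := continuous_hexpKappa x₀ j
  have hS := measurableSet_hexpSimplex x₀ x j
  have hprod := (integrable_prod_ofReal hα j).integrableOn (s := hexpSimplex x₀ x j)
  refine (hasDerivAt_integral_of_dominated_loc_of_deriv_le (𝕜 := ℂ)
    (F := fun σ s => hexpIntegrand x₀ α σ j s)
    (F' := fun σ s => 2 * Complex.I * (hexpKappa x₀ j s : ℂ) * hexpIntegrand x₀ α σ j s)
    (bound := fun s => 2 * K * Real.exp (2 * (‖σ₀‖ + 1) * K) * ‖∏ i, (α (s i) : ℂ)‖)
    (Metric.ball_mem_nhds σ₀ one_pos) ?_ ?_ ?_ ?_ ?_ ?_).2.differentiableAt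
  · exact Eventually.of_forall fun σ => (integrableOn_hexpIntegrand hα x₀ x σ j).aestronglyMeasurable
  · exact integrableOn_hexpIntegrand hα x₀ x σ₀ j
  · exact AEStronglyMeasurable.mul (by fun_prop)
      (integrableOn_hexpIntegrand hα x₀ x σ₀ j).aestronglyMeasurable
  · refine ae_restrict_of_forall_mem hS fun s hs σ hσ => ?_
    have hk := hK s hs
    have hσ' : ‖σ‖ ≤ ‖σ₀‖ + 1 := by
      have := norm_sub_norm_le σ σ₀
      rw [mem_ball_iff_norm] at hσ
      linarith
    have he : ‖Complex.exp (2 * Complex.I * σ * (hexpKappa x₀ j s : ℂ))‖ ≤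
        Real.exp (2 * (‖σ₀‖ + 1) * K) := by
      refine (Complex.norm_exp_le_exp_norm _).trans (Real.exp_le_exp.2 ?_)
      simp only [norm_mul, Complex.norm_I, Complex.norm_real, Real.norm_eq_abs, Complex.norm_ofNat,
        mul_one]
      gcongr
    simp only [hexpIntegrand, norm_mul, Complex.norm_I, Complex.norm_real, Real.norm_eq_abs,
      Complex.norm_ofNat, mul_one]
    rw [← mul_assoc]
    have := (abs_nonneg _).trans hk
    gcongr
  · exact hprod.norm.const_mul _
  · refine Eventually.of_forall fun s σ _ => ?_
    have h1 : HasDerivAt (fun σ : ℂ => 2 * Complex.I * σ * (hexpKappa x₀ j s : ℂ))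
        (2 * Complex.I * (hexpKappa x₀ j s : ℂ)) σ := by
      simpa using ((hasDerivAt_id σ).const_mul (2 * Complex.I)).mul_const (hexpKappa x₀ j s : ℂ)
    refine (h1.cexp.mul_const (∏ i, (α (s i) : ℂ))).congr_deriv ?_
    simp only [hexpIntegrand]
    ring

/-! ### Picard iterates and the integral equation -/

noncomputable section

/-- The phase factor `exp(2 i σ (t - x₀))`. -/
def hexpPhase (x₀ : ℝ) (σ : ℂ) (t : ℝ) : ℂ := Complex.exp (2 * Complex.I * σ * (t - x₀))

/-- The Picard iterates of the integral equation satisfied by the harmonic exponential. -/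
def hexpIter (x₀ : ℝ) (α : ℝ → ℝ) : ℕ → ℂ → ℝ → ℂ
  | 0 => fun _ _ => 1
  | n + 1 => fun σ x => ∫ t in x₀..x, hexpPhase x₀ σ t * α t * hexpIter x₀ α n (-σ) t

end

theorem hexpIter_succ (x₀ : ℝ) (α : ℝ → ℝ) (n : ℕ) (σ : ℂ) (x : ℝ) :
    hexpIter x₀ α (n + 1) σ x =
      ∫ t in x₀..x, hexpPhase x₀ σ t * α t * hexpIter x₀ α n (-σ) t := rfl

theorem continuous_hexpPhase (x₀ : ℝ) (σ : ℂ) : Continuous (hexpPhase x₀ σ) := by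
  unfold hexpPhase; fun_prop

theorem hexpPhase_neg_mul (x₀ : ℝ) (σ : ℂ) (t : ℝ) :
    hexpPhase x₀ (-σ) t * hexpPhase x₀ σ t = 1 := by
  rw [hexpPhase, hexpPhase, ← Complex.exp_add, ← Complex.exp_zero]
  congr 1; ring

theorem norm_hexpPhase (x₀ : ℝ) (σ : ℂ) (t : ℝ) :
    ‖hexpPhase x₀ σ t‖ = Real.exp (-2 * σ.im * (t - x₀)) := by
  rw [hexpPhase, Complex.norm_exp]
  congr 1
  simp [Complex.mul_re, Complex.mul_im]

theorem norm_hexpPhase_le {x₀ x₁ t R : ℝ} {σ : ℂ} (ht : t ∈ Icc x₀ x₁) (hσ : ‖σ‖ ≤ R) :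
    ‖hexpPhase x₀ σ t‖ ≤ Real.exp (2 * R * (x₁ - x₀)) := by
  rw [norm_hexpPhase]
  refine Real.exp_le_exp.2 ?_
  have h1 : -σ.im ≤ R := (neg_le_abs _).trans ((Complex.abs_im_le_norm σ).trans hσ)
  have h2 : 0 ≤ R := (norm_nonneg σ).trans hσ
  have h3 := ht.1
  have h4 := ht.2
  calc -2 * σ.im * (t - x₀) = 2 * (-σ.im * (t - x₀)) := by ring
    _ ≤ 2 * (R * (x₁ - x₀)) := by
      have h5 : -σ.im * (t - x₀) ≤ R * (t - x₀) :=
        mul_le_mul_of_nonneg_right h1 (by linarith)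
      have h6 : R * (t - x₀) ≤ R * (x₁ - x₀) := mul_le_mul_of_nonneg_left (by linarith) h2
      linarith
    _ = _ := by ring

theorem intervalIntegrable_phase_mul (hα : Integrable α) {x₀ a b : ℝ} {σ : ℂ} {g : ℝ → ℂ}
    (hg : ContinuousOn g (uIcc a b)) :
    IntervalIntegrable (fun t => hexpPhase x₀ σ t * α t * g t) volume a b := by
  have h := (hα.ofReal (𝕜 := ℂ)).intervalIntegrable (a := a) (b := b)
  exact (h.continuousOn_mul (continuous_hexpPhase x₀ σ).continuousOn).mul_continuousOn hg

theorem continuous_hexpIter (hα : Integrable α) (x₀ : ℝ) (n : ℕ) (σ : ℂ) :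
    Continuous (hexpIter x₀ α n σ) := by
  induction n generalizing σ with
  | zero => exact continuous_const
  | succ n ih =>
    exact intervalIntegral.continuous_primitive
      (fun a b => intervalIntegrable_phase_mul hα (ih (-σ)).continuousOn) x₀

theorem hexpTerm_eq_hexpIter (hα : Integrable α) {x₀ x : ℝ} (hx : x₀ ≤ x) (σ : ℂ) (n : ℕ) :
    hexpTerm x₀ x α σ n = hexpIter x₀ α n σ x := by
  induction n generalizing σ x with
  | zero => exact hexpTerm_zero _ _ _ _
  | succ n ih =>
    rw [hexpTerm_succ hα, hexpIter_succ, intervalIntegral.integral_of_le hx, integral_Ioc_eq_integral_Ioo]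
    refine setIntegral_congr_fun measurableSet_Ioo fun t ht => ?_
    simp only [hexpPhase]
    rw [ih ht.1.le]

/-- The recursion alternates between `σ` and `-σ`, so `B` must bound both phases. Keeping `B`
abstract allows `B = 1` for real `σ`, which makes the bound independent of `σ`. -/
theorem norm_hexpIter_le_of_phase_le (hα : Integrable α) {x₀ x₁ x B : ℝ} {σ : ℂ}
    (hx : x ∈ Icc x₀ x₁) (hB : ∀ t ∈ Icc x₀ x₁, ‖hexpPhase x₀ σ t‖ ≤ B)
    (hB' : ∀ t ∈ Icc x₀ x₁, ‖hexpPhase x₀ (-σ) t‖ ≤ B) (n : ℕ) :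
    ‖hexpIter x₀ α n σ x‖ ≤ (B * ∫ t in x₀..x₁, |α t|) ^ n / n.factorial := by
  have hB0 : 0 ≤ B := (norm_nonneg _).trans (hB x hx)
  -- The induction needs the bound with upper limit `x`: with `A(t) = ∫_{x₀}^t |α|`, the integral of
  -- `(n+1) Aⁿ |α|` is `A^{n+1}`, which produces the factorial.
  have hle : ‖hexpIter x₀ α n σ x‖ ≤ (B * ∫ t in x₀..x, |α t|) ^ n / n.factorial := by
    induction n generalizing σ x with
    | zero => simp [hexpIter]
    | succ n ih =>
      have hA := (ACHasDeriv.integral (a := x₀) (b := x) (hα.abs)).pow (n + 1)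
      have hbd : ∀ t ∈ Ioc x₀ x, ‖hexpPhase x₀ σ t * α t * hexpIter x₀ α n (-σ) t‖ ≤
          B ^ (n + 1) / (n + 1).factorial *
            ((n + 1 : ℕ) * (∫ s in x₀..t, |α s|) ^ (n + 1 - 1) * |α t|) := by
        intro t ht
        have ht' : t ∈ Icc x₀ x₁ := ⟨ht.1.le, ht.2.trans hx.2⟩
        rw [norm_mul, norm_mul, Complex.norm_real, Real.norm_eq_abs]
        calc _ ≤ B * |α t| * ((B * ∫ s in x₀..t, |α s|) ^ n / n.factorial) := by
              gcongr
              · exact hB t ht'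
              · exact ih ht' hB' (by rwa [neg_neg])
          _ = _ := by
            rw [Nat.factorial_succ, Nat.add_sub_cancel]
            push_cast
            field_simp
            ring
      have hcont : Continuous fun t => ∫ s in x₀..t, |α s| :=
        intervalIntegral.continuous_primitive (fun _ _ => hα.abs.intervalIntegrable) x₀
      have hi : IntervalIntegrable (fun t => B ^ (n + 1) / (n + 1).factorial *
          ((n + 1 : ℕ) * (∫ s in x₀..t, |α s|) ^ (n + 1 - 1) * |α t|)) volume x₀ x :=
        (hα.abs.intervalIntegrable.continuousOn_mul (by fun_prop)).const_mul _
      rw [hexpIter_succ]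
      refine (intervalIntegral.norm_integral_le_of_norm_le hx.1
        (Eventually.of_forall hbd) hi).trans_eq ?_
      rw [intervalIntegral.integral_const_mul, hA.integral_eq, intervalIntegral.integral_same,
        zero_pow (Nat.succ_ne_zero n), sub_zero, mul_pow]
      ring
  refine hle.trans ?_
  gcongr
  · exact mul_nonneg hB0 (intervalIntegral.integral_nonneg hx.1 fun _ _ => abs_nonneg _)
  · exact intervalIntegral.integral_mono_interval le_rfl hx.1 hx.2
      (Eventually.of_forall fun _ => abs_nonneg _) hα.abs.intervalIntegrable

theorem norm_hexpIter_le (hα : Integrable α) {x₀ x₁ x R : ℝ} {σ : ℂ}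
    (hx : x ∈ Icc x₀ x₁) (hσ : ‖σ‖ ≤ R) (n : ℕ) :
    ‖hexpIter x₀ α n σ x‖ ≤
      (Real.exp (2 * R * (x₁ - x₀)) * ∫ t in x₀..x₁, |α t|) ^ n / n.factorial :=
  norm_hexpIter_le_of_phase_le hα hx (fun _ ht => norm_hexpPhase_le ht hσ)
    (fun _ ht => norm_hexpPhase_le ht (by rwa [norm_neg])) n

theorem norm_hexpPhase_ofReal (x₀ σ t : ℝ) : ‖hexpPhase x₀ σ t‖ = 1 := by
  simp [norm_hexpPhase]

theorem norm_hexpIter_ofReal_le (hα : Integrable α) {x₀ x₁ x : ℝ} (hx : x ∈ Icc x₀ x₁)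
    (σ : ℝ) (n : ℕ) :
    ‖hexpIter x₀ α n σ x‖ ≤ (∫ t in x₀..x₁, |α t|) ^ n / n.factorial := by
  have h := norm_hexpIter_le_of_phase_le hα hx (σ := σ) (B := 1)
    (fun t _ => (norm_hexpPhase_ofReal x₀ σ t).le)
    (fun t _ => by simpa using (norm_hexpPhase_ofReal x₀ (-σ) t).le) n
  rwa [one_mul] at h

theorem summable_norm_hexpIter (hα : Integrable α) {x₀ x : ℝ} (hx : x₀ ≤ x) (σ : ℂ) :
    Summable fun n => ‖hexpIter x₀ α n σ x‖ :=
  Summable.of_nonneg_of_le (fun _ => norm_nonneg _)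
    (norm_hexpIter_le hα ⟨hx, le_rfl⟩ le_rfl) (Real.summable_pow_div_factorial _)

theorem hexp_eq_tsum (hα : Integrable α) {x₀ x : ℝ} (hx : x₀ ≤ x) (σ : ℂ) :
    hexp x₀ x α σ = ∑' n, hexpIter x₀ α n σ x := by
  rw [(summable_norm_hexpIter hα hx σ).of_norm.tsum_eq_zero_add, hexp]
  simp only [hexpTerm_eq_hexpIter hα hx]
  rfl

theorem continuousOn_hexp (hα : Integrable α) (x₀ x₁ : ℝ) (σ : ℂ) :
    ContinuousOn (fun x => hexp x₀ x α σ) (Icc x₀ x₁) := by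
  refine ContinuousOn.congr ?_ fun x hx => hexp_eq_tsum hα hx.1 σ
  exact continuousOn_tsum (fun n => (continuous_hexpIter hα x₀ n σ).continuousOn)
    (Real.summable_pow_div_factorial _) fun n x hx => norm_hexpIter_le hα hx le_rfl n

theorem hexp_integral_eq (hα : Integrable α) {x₀ x : ℝ} (hx : x₀ ≤ x) (σ : ℂ) :
    hexp x₀ x α σ = 1 + ∫ t in x₀..x, hexpPhase x₀ σ t * α t * hexp x₀ t α (-σ) := by
  have hsum : HasSum (fun n => ∫ t in x₀..x, hexpPhase x₀ σ t * α t * hexpIter x₀ α n (-σ) t)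
      (∫ t in x₀..x, hexpPhase x₀ σ t * α t * hexp x₀ t α (-σ)) := by
    have hI := fun n => intervalIntegrable_phase_mul hα (σ := σ) (x₀ := x₀) (a := x₀) (b := x)
      (continuous_hexpIter hα x₀ n (-σ)).continuousOn
    set C := Real.exp (2 * ‖-σ‖ * (x - x₀)) * ∫ t in x₀..x, |α t|
    refine intervalIntegral.hasSum_integral_of_dominated_convergence
      (fun n t => ‖hexpPhase x₀ σ t * α t‖ * (C ^ n / n.factorial))
      (fun n => (intervalIntegrable_iff.1 (hI n)).aestronglyMeasurable) (fun n => ?_) ?_ ?_ ?_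
    · refine Eventually.of_forall fun t ht => ?_
      rw [uIoc_of_le hx] at ht
      rw [norm_mul]
      gcongr
      exact norm_hexpIter_le hα ⟨ht.1.le, ht.2⟩ le_rfl n
    · exact Eventually.of_forall fun t _ => (Real.summable_pow_div_factorial C).mul_left _
    · simp only [tsum_mul_left]
      have := intervalIntegrable_phase_mul hα (σ := σ) (x₀ := x₀) (a := x₀) (b := x)
        (g := fun _ => 1) continuousOn_const
      simp only [mul_one] at this
      exact this.norm.mul_const _
    · refine Eventually.of_forall fun t ht => ?_
      rw [uIoc_of_le hx] at ht
      rw [hexp_eq_tsum hα ht.1.le]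
      exact (summable_norm_hexpIter hα ht.1.le (-σ)).of_norm.hasSum.mul_left _
  rw [hexp, ← hsum.tsum_eq]
  simp only [hexpTerm_eq_hexpIter hα hx]
  rfl

theorem differentiable_hexp (hα : Integrable α) {x₀ x : ℝ} (hx : x₀ ≤ x) :
    Differentiable ℂ (hexp x₀ x α) := by
  have h : hexp x₀ x α = fun σ => ∑' n, hexpTerm x₀ x α σ n := by
    ext σ
    simp only [hexp_eq_tsum hα hx, hexpTerm_eq_hexpIter hα hx]
  intro σ₀
  rw [h]
  have hd : DifferentiableOn ℂ (fun σ => ∑' n, hexpTerm x₀ x α σ n)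
      (Metric.ball (0 : ℂ) (‖σ₀‖ + 1)) := by
    refine Complex.differentiableOn_tsum_of_summable_norm
      (Real.summable_pow_div_factorial
        (Real.exp (2 * (‖σ₀‖ + 1) * (x - x₀)) * ∫ t in x₀..x, |α t|))
      (fun n => (differentiable_hexpTerm hα x₀ x n).differentiableOn) Metric.isOpen_ball
      fun n σ hσ => ?_
    rw [hexpTerm_eq_hexpIter hα hx]
    exact norm_hexpIter_le hα ⟨hx, le_rfl⟩ (mem_ball_zero_iff.1 hσ).le n
  exact hd.differentiableAt (Metric.isOpen_ball.mem_nhds (by simp))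

/-! ### Limit along the real line -/

/-- Only the first iterate needs oscillation (Riemann–Lebesgue). For later ones the inner iterate
already tends to zero pointwise, and dominated convergence suffices. -/
theorem tendsto_hexpIter (hα : Integrable α) {x₀ x : ℝ} (hx : x₀ ≤ x) (n : ℕ) :
    Tendsto (fun σ : ℝ => hexpIter x₀ α (n + 1) σ x) (comap (fun σ : ℝ => |σ|) atTop) (𝓝 0) := by
  induction n generalizing x with
  | zero =>
    have hc : comap (fun σ : ℝ => |σ|) atTop = cocompact ℝ := by
      rw [← Metric.cobounded_eq_cocompact, ← comap_norm_atTop]; rfl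
    -- The Fourier kernel is `e^{-2πi t w}`, so the frequency `w = -σ/π` yields `e^{2iσt}`.
    have hπ : -(1 / Real.pi) ≠ 0 := by simp [Real.pi_ne_zero]
    have h := (Real.tendsto_integral_exp_smul_cocompact
      ((Ioc x₀ x).indicator fun t => (α t : ℂ))).comp
      (Homeomorph.mulRight₀ _ hπ).isClosedEmbedding.tendsto_cocompact
    rw [hc]
    rw [tendsto_zero_iff_norm_tendsto_zero] at h ⊢
    refine h.congr fun σ => ?_
    have hphase : ∀ t : ℝ, hexpPhase x₀ σ t =
        Complex.exp (-(2 * Complex.I * σ * x₀)) * Complex.exp (2 * Complex.I * σ * t) := fun t => by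
      rw [hexpPhase, ← Complex.exp_add]; congr 1; ring
    have h1 : ‖Complex.exp (-(2 * Complex.I * σ * x₀))‖ = 1 := by
      rw [Complex.norm_exp]; simp
    rw [hexpIter_succ, intervalIntegral.integral_of_le hx, ← integral_indicator measurableSet_Ioc]
    simp only [hphase, hexpIter, mul_one, mul_assoc (Complex.exp (-(2 * Complex.I * σ * x₀))),
      Function.comp_apply]
    have h2 : ∀ z : ℂ, ‖z‖ = ‖Complex.exp (-(2 * Complex.I * σ * x₀)) * z‖ := fun z => by
      rw [norm_mul, h1, one_mul]
    rw [h2, ← integral_const_mul]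
    congr 2
    ext t
    by_cases ht : t ∈ Ioc x₀ x
    · simp only [indicator_of_mem ht, Circle.smul_def, Real.fourierChar_apply, smul_eq_mul]
      congr 3
      have := Complex.ofReal_ne_zero.2 Real.pi_ne_zero
      simp only [Homeomorph.coe_mulRight₀]
      push_cast
      field_simp
    · simp only [indicator_of_notMem ht, smul_zero, mul_zero]
  | succ n ih =>
    have hneg : Tendsto (fun σ : ℝ => -σ) (comap (fun σ : ℝ => |σ|) atTop)
        (comap (fun σ : ℝ => |σ|) atTop) := by
      rw [tendsto_comap_iff]
      simpa [Function.comp_def] using tendsto_comap (f := fun σ : ℝ => |σ|) (x := atTop)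
    have h0 : (0 : ℂ) = ∫ t in x₀..x, (0 : ℂ) := by simp
    simp only [hexpIter_succ x₀ α (n + 1)]
    rw [h0]
    refine intervalIntegral.tendsto_integral_filter_of_dominated_convergence
      (fun t => |α t| * ((∫ t in x₀..x, |α t|) ^ (n + 1) / (n + 1).factorial)) ?_ ?_ ?_ ?_
    · refine Eventually.of_forall fun σ => ?_
      exact (intervalIntegrable_iff.1 (intervalIntegrable_phase_mul hα
        (continuous_hexpIter hα x₀ (n + 1) (-σ)).continuousOn)).aestronglyMeasurable
    · refine Eventually.of_forall fun σ => Eventually.of_forall fun t ht => ?_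
      rw [uIoc_of_le hx] at ht
      rw [norm_mul, norm_mul, norm_hexpPhase_ofReal, one_mul, Complex.norm_real, Real.norm_eq_abs]
      gcongr
      exact_mod_cast norm_hexpIter_ofReal_le hα ⟨ht.1.le, ht.2⟩ (-σ) (n + 1)
    · exact hα.abs.intervalIntegrable.mul_const _
    · refine Eventually.of_forall fun t ht => ?_
      rw [uIoc_of_le hx] at ht
      have h := ((ih ht.1.le).comp hneg).norm.const_mul |α t|
      rw [tendsto_zero_iff_norm_tendsto_zero]
      simp only [norm_mul, norm_hexpPhase_ofReal, one_mul, Complex.norm_real, Real.norm_eq_abs]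
      simpa [Function.comp_def] using h

theorem tendsto_hexp (hα : Integrable α) {x₀ x : ℝ} (hx : x₀ ≤ x) :
    Tendsto (fun σ : ℝ => hexp x₀ x α σ) (comap (fun σ : ℝ => |σ|) atTop) (𝓝 1) := by
  have h := tendsto_tsum_of_dominated_convergence (f := fun (σ : ℝ) n => hexpIter x₀ α (n + 1) σ x)
    (𝓕 := comap (fun σ : ℝ => |σ|) atTop) (g := fun _ => (0 : ℂ))
    ((summable_nat_add_iff 1).2 (Real.summable_pow_div_factorial (∫ t in x₀..x, |α t|)))
    (fun n => tendsto_hexpIter hα hx n)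
    (Eventually.of_forall fun σ n => norm_hexpIter_ofReal_le hα ⟨hx, le_rfl⟩ σ (n + 1))
  simpa [hexp, hexpTerm_eq_hexpIter hα hx] using h.const_add 1

/-! ### The differential system and its invariants -/

theorem ACHasDeriv.congrOn {E : Type*} [NormedAddCommGroup E] [NormedSpace ℝ E] {a b : ℝ}
    {u f u' f' : ℝ → E} (h : ACHasDeriv u f a b) (hu : EqOn u' u (uIcc a b))
    (hf : EqOn f' f (uIcc a b)) : ACHasDeriv u' f' a b where
  ac := by
    rw [absolutelyContinuousOnInterval_iff]
    intro ε hε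
    obtain ⟨δ, hδ, H⟩ := (absolutelyContinuousOnInterval_iff u a b).1 h.ac ε hε
    refine ⟨δ, hδ, fun I hI hlt => ?_⟩
    refine (Finset.sum_congr rfl fun i hi => ?_).trans_lt (H I hI hlt)
    rw [hu (hI.1 i hi).1, hu (hI.1 i hi).2]
  deriv := by
    -- Agreement on the closed interval transfers derivatives only at interior points; the two
    -- endpoints form a null set.
    have hne : ∀ c : ℝ, ∀ᵐ x : ℝ, x ≠ c := fun c => by simp [ae_iff, measure_singleton]
    filter_upwards [h.deriv, hne (min a b), hne (max a b)] with x hx h₁ h₂ hmem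
    rw [hf hmem]
    refine (hx hmem).congr_of_eventuallyEq ?_
    have : uIcc a b ∈ 𝓝 x := Icc_mem_nhds (hmem.1.lt_of_ne' h₁) (hmem.2.lt_of_ne h₂)
    filter_upwards [this] with y hy using hu hy

theorem hexp_self (hα : Integrable α) (x₀ : ℝ) (σ : ℂ) : hexp x₀ x₀ α σ = 1 := by
  rw [hexp_integral_eq hα le_rfl, intervalIntegral.integral_same, add_zero]

theorem acHasDeriv_hexp (hα : Integrable α) {x₀ x : ℝ} (hx : x₀ ≤ x) (σ : ℂ) :
    ACHasDeriv (fun t => hexp x₀ t α σ)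
      (fun t => hexpPhase x₀ σ t * α t * hexp x₀ t α (-σ)) x₀ x := by
  -- Integrability of `f` is available only on `[x₀, x]`, so its extension by zero is integrated and
  -- then compared on that interval.
  set f : ℝ → ℂ := fun t => hexpPhase x₀ σ t * α t * hexp x₀ t α (-σ) with hf
  have hi : IntegrableOn f (Icc x₀ x) := by
    rw [← intervalIntegrable_iff_integrableOn_Icc_of_le hx]
    exact intervalIntegrable_phase_mul hα (by rw [uIcc_of_le hx]; exact continuousOn_hexp hα x₀ x _)
  have h := (ACHasDeriv.const (a := x₀) (b := x) (1 : ℂ)).add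
    (ACHasDeriv.integral (a := x₀) (b := x) ((integrable_indicator_iff measurableSet_Icc).2 hi))
  refine h.congrOn (fun t ht => ?_) (fun t ht => ?_)
  · rw [uIcc_of_le hx] at ht
    simp only
    rw [hexp_integral_eq hα ht.1]
    congr 1
    refine intervalIntegral.integral_congr fun s hs => ?_
    rw [uIcc_of_le ht.1] at hs
    rw [indicator_of_mem (show s ∈ Icc x₀ x from ⟨hs.1, hs.2.trans ht.2⟩)]
  · rw [uIcc_of_le hx] at ht
    simp only [zero_add]
    rw [indicator_of_mem ht]

theorem hexp_mul_add_mul_eq_two (hα : Integrable α) {x₀ x : ℝ} (hx : x₀ ≤ x) (σ : ℂ) :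
    hexp x₀ x α σ * hexp x₀ x (-α) (-σ) + hexp x₀ x α (-σ) * hexp x₀ x (-α) σ = 2 := by
  have h := (((acHasDeriv_hexp hα hx σ).mul (acHasDeriv_hexp hα.neg hx (-σ))).add
    ((acHasDeriv_hexp hα hx (-σ)).mul (acHasDeriv_hexp hα.neg hx σ))).congr (f' := fun _ => 0) rfl (by
      ext t
      simp only [neg_neg, Pi.neg_apply, Complex.ofReal_neg]
      ring)
  have := h.eq_of_zero
  simp only [hexp_self hα, hexp_self hα.neg] at this
  rw [this]
  norm_num

/-- Since `α` and `κ` are real, conjugation acts only on `iσ`, and the conjugate of `iσ` is `i(-conj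
σ)`. -/
theorem conj_hexp (x₀ x : ℝ) (α : ℝ → ℝ) (σ : ℂ) :
    conj (hexp x₀ x α σ) = hexp x₀ x α (-conj σ) := by
  have hT : ∀ j, conj (hexpTerm x₀ x α σ j) = hexpTerm x₀ x α (-conj σ) j := fun j => by
    rw [hexpTerm, hexpTerm, ← integral_conj]
    congr 1
    ext s
    simp only [hexpIntegrand, map_mul, map_prod, ← Complex.exp_conj, Complex.conj_ofReal,
      Complex.conj_I, map_ofNat]
    congr 2
    ring
  rw [hexp, hexp, map_add, map_one, Complex.conj_tsum]
  simp only [hT]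

theorem re_hexp_mul_conj (hα : Integrable α) {x₀ x : ℝ} (hx : x₀ ≤ x) (σ : ℝ) :
    (hexp x₀ x α σ * conj (hexp x₀ x (-α) σ)).re = 1 := by
  have h := hexp_mul_add_mul_eq_two hα hx σ
  have h1 := conj_hexp x₀ x α σ
  have h2 := conj_hexp x₀ x (-α) σ
  rw [Complex.conj_ofReal] at h1 h2
  rw [← h1, ← h2] at h
  have := congrArg Complex.re h
  simp only [Complex.add_re, Complex.mul_re, Complex.conj_re, Complex.conj_im,
    Complex.re_ofNat] at this ⊢
  linarith

/-! ### Energy monotonicity and its consequences -/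

theorem ACHasDeriv.normSq {u f : ℝ → ℂ} {a b : ℝ} (h : ACHasDeriv u f a b) :
    ACHasDeriv (fun x => Complex.normSq (u x)) (fun x => 2 * (f x * conj (u x)).re) a b := by
  have hre := h.clm Complex.reCLM
  have him := h.clm Complex.imCLM
  refine ((hre.mul hre).add (him.mul him)).congr ?_ ?_
  · ext x; simp [Complex.normSq_apply]
  · ext x; simp [Complex.mul_re]; ring

/-- If `U' = e^{2iσ(t-x₀)} α Z` and `Z' = e^{-2iσ(t-x₀)} α U` with `Im σ ≥ 0`, then the quantity
`|U|² - e^{-4 Im σ (t-x₀)} |Z|²` is nondecreasing. -/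
theorem energy_le {x₀ x : ℝ} (hx : x₀ ≤ x) {σ : ℂ} (hσ : 0 ≤ σ.im) {U Z : ℝ → ℂ}
    (hU : ACHasDeriv U (fun t => hexpPhase x₀ σ t * α t * Z t) x₀ x)
    (hZ : ACHasDeriv Z (fun t => hexpPhase x₀ (-σ) t * α t * U t) x₀ x) :
    Complex.normSq (U x₀) - Complex.normSq (Z x₀) ≤
      Complex.normSq (U x) - Real.exp (-4 * σ.im * (x - x₀)) * Complex.normSq (Z x) := by
  have hw : ACHasDeriv (fun t => Real.exp (-4 * σ.im * (t - x₀)))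
      (fun t => Real.exp (-4 * σ.im * (t - x₀)) * (-4 * σ.im)) x₀ x := by
    refine .of_contDiff (by fun_prop) fun t => ?_
    simpa using (((hasDerivAt_id t).sub_const x₀).const_mul (-4 * σ.im)).exp
  have h := (hU.normSq.sub (hw.mul hZ.normSq)).le_of_nonneg hx fun t _ => by
    -- The weight is `|φ|²`, and `|φ|² φ⁻¹` is the conjugate of `φ`. Hence the cross terms in the
    -- energy derivative cancel, leaving `4 Im σ |φ|² |Z|² ≥ 0`.
    have hwp : (Real.exp (-4 * σ.im * (t - x₀)) : ℂ) * hexpPhase x₀ (-σ) t =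
        conj (hexpPhase x₀ σ t) := by
      have h1 : (Real.exp (-4 * σ.im * (t - x₀)) : ℂ) =
          conj (hexpPhase x₀ σ t) * hexpPhase x₀ σ t := by
        rw [← Complex.normSq_eq_conj_mul_self, Complex.normSq_eq_norm_sq, norm_hexpPhase,
          ← Real.exp_nat_mul]
        congr 2
        push_cast
        ring
      rw [h1, mul_assoc, mul_comm (hexpPhase x₀ σ t), hexpPhase_neg_mul, mul_one]
    have hr := congrArg Complex.re hwp
    have him := congrArg Complex.im hwp
    rw [Complex.re_ofReal_mul, Complex.conj_re] at hr
    rw [Complex.im_ofReal_mul, Complex.conj_im] at him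
    have hpos : 0 ≤ 4 * σ.im * Real.exp (-4 * σ.im * (t - x₀)) * Complex.normSq (Z t) := by
      have := Complex.normSq_nonneg (Z t)
      positivity
    refine hpos.trans_eq ?_
    simp only [Complex.mul_re, Complex.mul_im, Complex.conj_re, Complex.conj_im,
      Complex.ofReal_re, Complex.ofReal_im]
    linear_combination
      (2 * α t * ((U t).re * (Z t).re + (U t).im * (Z t).im)) * hr
        + (2 * α t * ((U t).re * (Z t).im - (U t).im * (Z t).re)) * him
  simpa only [sub_self, mul_zero, Real.exp_zero, one_mul] using h

/-- The energy of the pair `E_α(σ)`, `E_α(-σ)` starts at `0`. A zero of the first would force a zero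
of the second, and then the invariant `2` would vanish. -/
theorem hexp_ne_zero (hα : Integrable α) {x₀ x : ℝ} (hx : x₀ ≤ x) {σ : ℂ} (hσ : 0 ≤ σ.im) :
    hexp x₀ x α σ ≠ 0 := by
  intro h0
  have h := energy_le (α := α) hx hσ (acHasDeriv_hexp hα hx σ)
    ((acHasDeriv_hexp hα hx (-σ)).congr rfl (by simp only [neg_neg]))
  simp only [hexp_self hα, sub_self, h0, map_zero, zero_sub, Left.nonneg_neg_iff] at h
  have hz : hexp x₀ x α (-σ) = 0 := by
    rw [← Complex.normSq_eq_zero]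
    exact le_antisymm (nonpos_of_mul_nonpos_right h (Real.exp_pos _)) (Complex.normSq_nonneg _)
  have := hexp_mul_add_mul_eq_two hα hx σ
  rw [h0, hz] at this
  norm_num at this

/-- The sum at `σ` and the difference at `-σ` solve the same system with initial values `2` and `0`,
so the energy starts at `4`; dropping its negative part bounds `|U|²` below. -/
theorem two_le_norm_hexp_add (hα : Integrable α) {x₀ x : ℝ} (hx : x₀ ≤ x) {σ : ℂ}
    (hσ : 0 ≤ σ.im) : 2 ≤ ‖hexp x₀ x α σ + hexp x₀ x (-α) σ‖ := by
  have h := energy_le (α := α) hx hσ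
    (U := fun t => hexp x₀ t α σ + hexp x₀ t (-α) σ)
    (Z := fun t => hexp x₀ t α (-σ) - hexp x₀ t (-α) (-σ))
    (((acHasDeriv_hexp hα hx σ).add (acHasDeriv_hexp hα.neg hx σ)).congr rfl
      (by ext t; simp only [Pi.neg_apply, Complex.ofReal_neg]; ring))
    (((acHasDeriv_hexp hα hx (-σ)).sub (acHasDeriv_hexp hα.neg hx (-σ))).congr rfl
      (by ext t; simp only [Pi.neg_apply, Complex.ofReal_neg, neg_neg]; ring))
  simp only [hexp_self hα, hexp_self hα.neg, sub_self, map_zero, sub_zero] at h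
  replace h := h.trans (sub_le_self _ (mul_nonneg (Real.exp_pos _).le (Complex.normSq_nonneg _)))
  rw [Complex.normSq_eq_norm_sq, Complex.normSq_eq_norm_sq] at h
  have h2 : ‖(1 + 1 : ℂ)‖ = 2 := by norm_num
  rw [h2] at h
  exact le_of_sq_le_sq h (norm_nonneg _)

theorem hexpCosh_I_im (x₀ x : ℝ) (α : ℝ → ℝ) : (hexpCosh x₀ x α Complex.I).im = 0 := by
  have h : ∀ β : ℝ → ℝ, conj (hexp x₀ x β Complex.I) = hexp x₀ x β Complex.I := fun β => by
    rw [conj_hexp, Complex.conj_I, neg_neg]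
  rw [← Complex.conj_eq_iff_im, hexpCosh, map_div₀, map_add, h, h, map_ofNat]

/-- As a function of the endpoint, `Cosh_α(i)` is real, continuous and equal to `1` at `x₀`; a
change of sign would produce a zero, which the lower bound forbids. -/
theorem hexpCosh_I_re_pos (hα : Integrable α) {x₀ x : ℝ} (hx : x₀ ≤ x) :
    0 < (hexpCosh x₀ x α Complex.I).re := by
  by_contra! hle
  have hc : ContinuousOn (fun t => (hexpCosh x₀ t α Complex.I).re) (Icc x₀ x) := by
    unfold hexpCosh
    exact Complex.continuous_re.comp_continuousOn
      (((continuousOn_hexp hα x₀ x _).add (continuousOn_hexp hα.neg x₀ x _)).div_const 2)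
  have h1 : (hexpCosh x₀ x₀ α Complex.I).re = 1 := by
    rw [hexpCosh, hexp_self hα, hexp_self hα.neg]; norm_num
  obtain ⟨t, ht, h0⟩ := intermediate_value_Icc' hx hc
    (⟨hle, by rw [h1]; exact zero_le_one⟩ : (0 : ℝ) ∈ Icc _ _)
  have hz : hexpCosh x₀ t α Complex.I = 0 := Complex.ext h0 (hexpCosh_I_im x₀ t α)
  have h2 := two_le_norm_hexp_add hα ht.1 (σ := Complex.I) (by simp)
  rw [hexpCosh, div_eq_zero_iff, or_iff_left two_ne_zero] at hz
  rw [hz, norm_zero] at h2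
  norm_num at h2

/-! ### Reduction to a globally integrable `α` -/

theorem hexpTerm_congr {x₀ x : ℝ} {α β : ℝ → ℝ} (h : EqOn α β (Ioo x₀ x)) (σ : ℂ) (j : ℕ) :
    EqOn (hexpIntegrand x₀ α σ j) (hexpIntegrand x₀ β σ j) (hexpSimplex x₀ x j) ∧
      hexpTerm x₀ x α σ j = hexpTerm x₀ x β σ j := by
  have hE : EqOn (hexpIntegrand x₀ α σ j) (hexpIntegrand x₀ β σ j) (hexpSimplex x₀ x j) :=
    fun s hs => by
      simp only [hexpIntegrand]
      congr 1
      exact Finset.prod_congr rfl fun i _ => by rw [h (hs.2 i)]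
  exact ⟨hE, setIntegral_congr_fun (measurableSet_hexpSimplex x₀ x j) hE⟩

theorem hexp_congr {x₀ x : ℝ} {α β : ℝ → ℝ} (h : EqOn α β (Ioo x₀ x)) :
    hexp x₀ x α = hexp x₀ x β := by
  ext σ
  simp only [hexp, (hexpTerm_congr h σ _).2]

end HarmonicExponential

theorem mainTheorem5 (x₀ x₁ : ℝ) (α : ℝ → ℝ) (hα : IntegrableOn α (Ioo x₀ x₁) volume)
    (x : ℝ) (hx : x ∈ Ioc x₀ x₁) :
    -- the integrals and the series that define `E_α` converge absolutely
    (∀ σ : ℂ, (∀ j : ℕ, 1 ≤ j →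
        IntegrableOn (hexpIntegrand x₀ α σ j) (hexpSimplex x₀ x j) volume) ∧
      Summable (fun n : ℕ => ‖hexpTerm x₀ x α σ (n + 1)‖)) ∧
    -- entire
    Differentiable ℂ (hexp x₀ x α) ∧
    -- limit at infinity along the real line
    Tendsto (fun σ : ℝ => hexp x₀ x α (σ : ℂ)) (comap (fun σ : ℝ => |σ|) atTop) (𝓝 1) ∧
    -- real part identity
    (∀ σ : ℝ, (hexp x₀ x α (σ : ℂ) * (starRingEnd ℂ) (hexp x₀ x (-α) (σ : ℂ))).re = 1) ∧
    -- no zeros in the closed upper half plane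
    (∀ σ : ℂ, 0 ≤ σ.im →
      hexp x₀ x α σ ≠ 0 ∧ hexp x₀ x α σ + hexp x₀ x (-α) σ ≠ 0) ∧
    -- lower bound
    (∀ σ : ℂ, 0 ≤ σ.im → √2 ≤ ‖hexp x₀ x α σ + hexp x₀ x (-α) σ‖) ∧
    -- `Sech_α(i)` is real and positive
    ((hexpSech x₀ x α Complex.I).im = 0 ∧ 0 < (hexpSech x₀ x α Complex.I).re) := by
  -- Nothing is assumed about `α` outside the interval. Its extension by zero is integrable on `ℝ`
  -- and leaves the simplex integrals unchanged.
  set β := (Ioo x₀ x₁).indicator α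
  have hβ : Integrable β := (integrable_indicator_iff measurableSet_Ioo).2 hα
  have hαβ : EqOn α β (Ioo x₀ x) := fun t ht =>
    (indicator_of_mem (show t ∈ Ioo x₀ x₁ from ⟨ht.1, ht.2.trans_le hx.2⟩) α).symm
  have hneg : EqOn (-α) (-β) (Ioo x₀ x) := fun t ht => congrArg Neg.neg (hαβ ht)
  have hle : x₀ ≤ x := hx.1.le
  have hsqrt : √2 ≤ (2 : ℝ) := by
    rw [Real.sqrt_le_left two_pos.le]; norm_num
  have hsech : hexpSech x₀ x α Complex.I = (((hexpCosh x₀ x β Complex.I).re)⁻¹ : ℝ) := by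
    have : hexpCosh x₀ x β Complex.I = ((hexpCosh x₀ x β Complex.I).re : ℂ) :=
      Complex.ext rfl (by simpa using hexpCosh_I_im x₀ x β)
    rw [Complex.ofReal_inv, ← this, hexpSech, one_div, hexpCosh, hexpCosh, hexp_congr hαβ,
      hexp_congr hneg]
  rw [hsech, hexp_congr hαβ, hexp_congr hneg]
  refine ⟨fun σ => ⟨fun j _ => ?_, ?_⟩, differentiable_hexp hβ hle, tendsto_hexp hβ hle,
    re_hexp_mul_conj hβ hle, fun σ hσ => ⟨hexp_ne_zero hβ hle hσ, fun h => ?_⟩,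
    fun σ hσ => hsqrt.trans (two_le_norm_hexp_add hβ hle hσ), Complex.ofReal_im _, ?_⟩
  · exact (integrableOn_hexpIntegrand hβ x₀ x σ j).congr_fun (hexpTerm_congr hαβ σ j).1.symm
      (measurableSet_hexpSimplex x₀ x j)
  · simp only [(hexpTerm_congr hαβ σ _).2, hexpTerm_eq_hexpIter hβ hle]
    exact (summable_nat_add_iff 1).2 (summable_norm_hexpIter hβ hle σ)
  · have h2 := two_le_norm_hexp_add hβ hle hσ
    rw [h, norm_zero] at h2
    norm_num at h2
  · rw [Complex.ofReal_re]
    exact inv_pos.2 (hexpCosh_I_re_pos hβ hle)
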